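/- All graphs are finite and simple. For graphs $H$ and $G$ let $\mathcal N(H,G)$ be the number of copies of $H$ in $G$, i.e. the number of (not necessarily induced) subgraphs of $G$ isomorphic to $H$; a graph is $F$-free if it does not contain $F$ as a subgraph. Let $T_{k-1}(n)$ be the Turán graph, the complete $(k-1)$-partite graph on $n$ vertices in which each class has size $\lceil n/(k-1)\rceil$ or $\lfloor n/(k-1)\rfloor$, and let $\mathrm{ex}(n,H,K_k)=\max\{\mathcal N(H,G): G\text{ is an } n\text{-vertex } K_k\text{-free graph}\}$. A graph $H$ is called $k$-Turán-good if $H$ is $K_k$-free and there is an $n_0$ (which may depend on $H$ and $k$) such that $\mathrm{ex}(n,H,K_k)=\mathcal N(H,T_{k-1}(n))$ for all $n\ge n_0$. Theorem. For every complete multipartite graph $H$ there is an integer $k_0$ such that, for every $k\ge k_0$, the graph $H$ is $k$-Turán-good. -/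

import Mathlib

namespace GenTuran

open Classical in
/-- The generalized Turán number `ex(n, H, F)`: the maximum number of (unlabelled, not necessarily
induced) copies of `H` in an `n`-vertex `F`-free graph `G`. Here `F.Free G` says that `G` does not
contain `F` as a subgraph, and `G.copyCount H` is the number of subgraphs of `G` isomorphic
to `H`. -/
noncomputable def ex {V W : Type*} (n : ℕ) (H : SimpleGraph W) (F : SimpleGraph V) : ℕ :=
  (Finset.univ.filter fun G : SimpleGraph (Fin n) => F.Free G).sup fun G => G.copyCount H

/-- For a `k`-chromatic graph `F`, the graph `H` is `F`-Turán-good if `H` does not contain `F` as a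
subgraph and, for every sufficiently large `n`, `ex(n, H, F)` equals the number of copies of `H` in
the Turán graph `T_{k-1}(n)`. -/
def IsTuranGood {V W : Type*} (k : ℕ) (F : SimpleGraph V) (H : SimpleGraph W) : Prop :=
  F.chromaticNumber = k ∧ F.Free H ∧
    ∀ᶠ n : ℕ in Filter.atTop, ex n H F = (SimpleGraph.turanGraph n (k - 1)).copyCount H

/-- `H` is `k`-Turán-good if it is `K_k`-Turán-good. -/
def IsCliqueTuranGood {W : Type*} (k : ℕ) (H : SimpleGraph W) : Prop :=
  IsTuranGood k (⊤ : SimpleGraph (Fin k)) H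

end GenTuran

/-! Copies of `H` are counted through injective homomorphisms, `|Aut H|` for each copy. Take a
`K_{r+1}`-free graph with the most such maps and, subject to that, the most edges. Zykov
symmetrization applies because `H` is complete multipartite: if a map hits two nonadjacent vertices,
their preimages are twins in `H`, so the map survives when one vertex becomes a clone of the other
(`two_mul_card_injMaps_le`). Hence the extremal graph is complete multipartite with at most `r`
classes (`exists_classGraph_eq`).

It remains to balance the classes, and here `r` must be large. All but an `O(1/r)` fraction of maps
into the Turán graph use distinct classes, whereas a class of size `d` spoils a `(d/n)^2` fraction;
so every extremal class has size `O(n/√r)` (`card_class_sq_le`). With all classes this small, moving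
a vertex to a class smaller by at least two strictly gains maps (`card_injMaps_lt_of_exchange`). -/

namespace GenTuran

open Finset Function

/-! ### Counting maps by resampling one coordinate. -/

section Counting

variable {W V : Type*} [Fintype W] [DecidableEq W] [Fintype V]

open Classical in
/-- Resampling one coordinate: if `P` and `R` do not depend on the coordinate `a`, the maps `f`
with `P f` and `R f (f a)` can be counted by choosing the value at `a` last. -/
lemma card_filter_coord_mul (a : W) (P : (W → V) → Prop) (R : (W → V) → V → Prop)
    (hP : ∀ f v, P (update f a v) ↔ P f) (hR : ∀ f v x, R (update f a v) x ↔ R f x) :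
    #{f | P f ∧ R f (f a)} * Fintype.card V = ∑ f with P f, #{v | R f v} := by
  rw [← card_univ, ← card_product, ← card_sigma]
  refine card_bij' (fun p _ => ⟨update p.1 a p.2, p.1 a⟩) (fun p _ => (update p.1 a p.2, p.1 a))
    ?_ ?_ ?_ ?_
  · rintro ⟨f, v⟩ h
    simp only [mem_product, mem_filter, mem_univ, true_and, and_true] at h
    simp [hP, hR, h.1, h.2]
  · rintro ⟨f, v⟩ h
    simp only [mem_sigma, mem_filter, mem_univ, true_and] at h
    simp [hP, hR, h.1, h.2]
  · rintro ⟨f, v⟩ -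
    simp
  · rintro ⟨f, v⟩ -
    simp

open Classical in
/-- The number of maps satisfying `P`. -/
noncomputable def countMaps (P : (W → V) → Prop) : ℕ := #{f | P f}

lemma card_filter_eq_countMaps (P : (W → V) → Prop) [DecidablePred P] :
    #{f | P f} = countMaps P := by
  unfold countMaps
  congr!

open Classical in
lemma countMaps_coord_mul_le (a : W) (P : (W → V) → Prop) (R : (W → V) → V → Prop)
    (hP : ∀ f v, P (update f a v) ↔ P f) (hR : ∀ f v x, R (update f a v) x ↔ R f x)
    {D : ℕ} (hD : ∀ f, #{v | R f v} ≤ D) :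
    countMaps (fun f => P f ∧ R f (f a)) * Fintype.card V ≤ D * countMaps P := by
  have h := card_filter_coord_mul a P R hP hR
  simp only [card_filter_eq_countMaps] at h
  rw [h, mul_comm, ← card_filter_eq_countMaps P]
  exact sum_le_card_nsmul _ _ _ fun f _ => hD f

lemma countMaps_coord_mem_mul (a : W) (P : (W → V) → Prop) (S : Finset V)
    (hP : ∀ f v, P (update f a v) ↔ P f) :
    countMaps (fun f => P f ∧ f a ∈ S) * Fintype.card V = #S * countMaps P := by
  classical
  have h := card_filter_coord_mul a P (fun _ v => v ∈ S) hP (by simp)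
  simp only [card_filter_eq_countMaps] at h
  rw [h, ← card_filter_eq_countMaps P]
  simp [mul_comm]

/-- Being exact, the count does not depend on which pair `a ≠ b` is prescribed; the exchange
argument relies on this. -/
lemma countMaps_two_mem_mul {a b : W} (hab : a ≠ b) (S T : Finset V) :
    countMaps (fun f : W → V => f a ∈ S ∧ f b ∈ T) * Fintype.card V ^ 2 =
      #S * #T * Fintype.card V ^ Fintype.card W := by
  have h1 := countMaps_coord_mem_mul b (fun f : W → V => f a ∈ S) T (by simp [hab])
  have h2 := countMaps_coord_mem_mul a (fun f : W → V => True) S (by simp)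
  rw [← card_filter_eq_countMaps (fun f : W → V => True)] at h2
  simp only [true_and, filter_true, card_univ, Fintype.card_fun] at h2
  rw [pow_two, ← mul_assoc, h1, mul_assoc, h2]
  ring

/-- Among the maps `f` satisfying `P`, few send some pair of distinct points of `W`, the first one
outside the support of `P`, to the same colour. -/
lemma countMaps_collision_mul_le {ι : Type*} [DecidableEq ι] (c : V → ι) (A : Finset W)
    (P : (W → V) → Prop) (hP : ∀ a ∉ A, ∀ f v, P (update f a v) ↔ P f)
    {D : ℕ} (hD : ∀ i, #{v | c v = i} ≤ D) :
    countMaps (fun f => P f ∧ ∃ a ∉ A, ∃ b ≠ a, c (f a) = c (f b)) * Fintype.card V ≤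
      Fintype.card W ^ 2 * D * countMaps P := by
  classical
  have hsub : ({f | P f ∧ ∃ a ∉ A, ∃ b ≠ a, c (f a) = c (f b)} : Finset (W → V)) ⊆
      ({p : W × W | p.1 ∉ A ∧ p.2 ≠ p.1} : Finset (W × W)).biUnion
        fun p => {f | P f ∧ c (f p.1) = c (f p.2)} := by
    intro f
    simp only [mem_filter, mem_univ, true_and, mem_biUnion, Prod.exists]
    rintro ⟨hf, a, ha, b, hb, h⟩
    exact ⟨a, b, ⟨ha, hb⟩, hf, h⟩
  have hle := (card_le_card hsub).trans card_biUnion_le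
  simp only [card_filter_eq_countMaps] at hle
  calc _ ≤ (∑ p : W × W with p.1 ∉ A ∧ p.2 ≠ p.1,
          countMaps fun f => P f ∧ c (f p.1) = c (f p.2)) * Fintype.card V :=
        Nat.mul_le_mul_right _ hle
    _ = ∑ p : W × W with p.1 ∉ A ∧ p.2 ≠ p.1,
        countMaps (fun f => P f ∧ c (f p.1) = c (f p.2)) * Fintype.card V := by rw [sum_mul]
    _ ≤ ∑ p : W × W with p.1 ∉ A ∧ p.2 ≠ p.1, D * countMaps P := by
        refine sum_le_sum fun p hp => ?_
        simp only [mem_filter, mem_univ, true_and] at hp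
        exact countMaps_coord_mul_le (D := D) p.1 P (fun f v => c v = c (f p.2))
          (hP _ hp.1) (by simp [hp.2]) fun f => by convert hD (c (f p.2))
    _ ≤ Fintype.card W ^ 2 * (D * countMaps P) := by
        rw [sum_const, smul_eq_mul]
        refine Nat.mul_le_mul_right _ ((card_le_univ _).trans ?_)
        rw [Fintype.card_prod, pow_two]
    _ = _ := by ring

end Counting

/-! ### Moving a vertex to a smaller class. -/

open Classical in
/-- The injective maps that send edges of `H` to edges of `G`. -/
noncomputable def injMaps {W V : Type*} [Fintype W] [Fintype V] (H : SimpleGraph W)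
    (G : SimpleGraph V) : Finset (W → V) :=
  {f | Injective f ∧ ∀ a b, H.Adj a b → G.Adj (f a) (f b)}

@[simp]
lemma mem_injMaps {W V : Type*} [Fintype W] [Fintype V] {H : SimpleGraph W}
    {G : SimpleGraph V} {f : W → V} :
    f ∈ injMaps H G ↔ Injective f ∧ ∀ a b, H.Adj a b → G.Adj (f a) (f b) := by
  simp [injMaps]

/-- The complete multipartite graph whose parts are the classes of the colouring `c`. -/
abbrev classGraph {V ι : Type*} (c : V → ι) : SimpleGraph V := (⊤ : SimpleGraph ι).comap c

lemma classGraph_adj {V ι : Type*} (c : V → ι) {u v : V} :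
    (classGraph c).Adj u v ↔ c u ≠ c v := by
  simp



/-- Two disjoint sets of the same size are exchanged by an involution fixing everything else. -/
lemma exists_perm_exchange {V : Type*} [DecidableEq V] {A B : Finset V}
    (hAB : Disjoint A B) (hcard : #A = #B) :
    ∃ σ : Equiv.Perm V, (∀ v ∈ A, σ v ∈ B) ∧ (∀ v ∈ B, σ v ∈ A) ∧
      ∀ v, v ∉ A → v ∉ B → σ v = v := by
  let e := Finset.equivOfCardEq hcard
  let s : V → V := fun v => if h : v ∈ A then e ⟨v, h⟩ else
    if h : v ∈ B then e.symm ⟨v, h⟩ else v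
  have hA : ∀ v (h : v ∈ A), s v = e ⟨v, h⟩ := fun v h => dif_pos h
  have hB : ∀ v (h : v ∈ B), s v = e.symm ⟨v, h⟩ := fun v h => by
    simp only [s]
    rw [dif_neg fun h' => Finset.disjoint_left.1 hAB h' h, dif_pos h]
  have hs : Involutive s := by
    intro v
    by_cases h : v ∈ A
    · rw [hA v h, hB _ (e ⟨v, h⟩).2]; simp
    by_cases h' : v ∈ B
    · rw [hB v h', hA _ (e.symm ⟨v, h'⟩).2]; simp
    · simp [s, h, h']
  refine ⟨hs.toPerm, fun v h => ?_, fun v h => ?_, fun v h h' => ?_⟩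
  · rw [hs.coe_toPerm, hA v h]; exact (e _).2
  · rw [hs.coe_toPerm, hB v h]; exact (e.symm _).2
  · rw [hs.coe_toPerm]; simp [s, h, h']

-- The move frees `z` from the surplus vertices `L` of its old class and ties it to class `j`.
-- Gained maps need only two prescribed values, at `z` and in `L`. Among maps meeting `L`, a lost
-- one must also meet class `j`, which costs a further factor `D / n`. Maps avoiding `L` are
-- preserved by symmetry.
open Classical in
lemma card_injMaps_lt_of_exchange {W V ι : Type*} [Fintype W] [Fintype V] [DecidableEq V]
    [DecidableEq ι] (H : SimpleGraph W) {w₀ u₀ : W} (hwu : H.Adj w₀ u₀)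
    (c : V → ι) {i j : ι} (hij : i ≠ j) {z : V} (hz : c z = i) {D : ℕ}
    (hD : ∀ l, #{v | c v = l} ≤ D) (hlt : #{v | c v = j} + 2 ≤ #{v | c v = i})
    (hn : (Fintype.card W ^ 2 + Fintype.card W ^ 3) * D < Fintype.card V) :
    #(injMaps H (classGraph c)) < #(injMaps H (classGraph (update c z j))) := by
  set c' := update c z j with hc'
  have hc'z : c' z = j := by simp [hc']
  have hc'v : ∀ v ≠ z, c' v = c v := fun v hv => by simp [hc', hv]
  have hwu' := hwu.ne
  -- the part of class `i` matched with class `j`, and the unmatched rest `L`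
  obtain ⟨A, hAsub, hAcard⟩ : ∃ A ⊆ ({v | c v = i} : Finset V).erase z,
      #A = #({v | c v = j} : Finset V) := by
    apply exists_subset_card_eq
    rw [card_erase_of_mem (by simp [hz])]
    omega
  set B : Finset V := {v | c v = j} with hB
  have hA : ∀ v ∈ A, v ≠ z ∧ c v = i := fun v hv => by simpa using hAsub hv
  have hBm : ∀ v, v ∈ B ↔ c v = j := by simp [hB]
  set L : Finset V := ({v | c v = i} : Finset V).erase z \ A with hL
  have hLm : ∀ v, v ∈ L ↔ (v ≠ z ∧ c v = i) ∧ v ∉ A := by simp [hL]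
  have hLpos : 0 < #L := by
    rw [hL, card_sdiff_of_subset hAsub, card_erase_of_mem (by simp [hz])]
    omega
  have hAB : Disjoint A B := by
    rw [Finset.disjoint_left]
    intro v hvA hvB
    rw [hBm] at hvB
    exact hij ((hA v hvA).2.symm.trans hvB)
  obtain ⟨σ, hσA, hσB, hσ⟩ := exists_perm_exchange hAB hAcard
  -- Off `L` the two classes are `A ∪ {z}`, `B` before the move and `A`, `B ∪ {z}` after it, so `σ`
  -- matches the two graphs.
  have hcσ : ∀ v ∉ L, c' (σ v) = Equiv.swap i j (c v) := by
    intro v hv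
    by_cases hvA : v ∈ A
    · have h1 := hσA v hvA
      rw [hBm] at h1
      rw [hc'v _ (by rintro h; rw [h, hz] at h1; exact hij h1), h1, (hA v hvA).2,
        Equiv.swap_apply_left]
    by_cases hvB : v ∈ B
    · have h1 := hA _ (hσB v hvB)
      rw [hc'v _ h1.1, h1.2, (hBm v).1 hvB, Equiv.swap_apply_right]
    rw [hσ v hvA hvB]
    by_cases hvz : v = z
    · rw [hvz, hc'z, hz, Equiv.swap_apply_left]
    · rw [hc'v v hvz, Equiv.swap_apply_of_ne_of_ne]
      · intro h; exact hv ((hLm v).2 ⟨⟨hvz, h⟩, hvA⟩)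
      · rwa [hBm] at hvB
  -- maps avoiding `L`
  have havoid : #{f ∈ injMaps H (classGraph c) | ¬ ∃ w, f w ∈ L} ≤
      #{f ∈ injMaps H (classGraph c') | ¬ ∃ w, f w ∈ L} := by
    refine card_le_card_of_injOn (fun f => σ ∘ f) ?_ ?_
    · intro f hf
      simp only [coe_filter, mem_injMaps, classGraph_adj, Set.mem_ofPred_eq, not_exists] at hf ⊢
      obtain ⟨⟨hinj, hadj⟩, hfL⟩ := hf
      refine ⟨⟨σ.injective.comp hinj, fun a b hab => ?_⟩, fun w hw => ?_⟩
      · simp only [comp_apply, hcσ _ (hfL _)]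
        exact (Equiv.swap i j).injective.ne (hadj a b hab)
      · have h1 := (hLm _).1 hw
        have h2 : c' (σ (f w)) = i := (hc'v _ h1.1.1).trans h1.1.2
        rw [hcσ _ (hfL w), Equiv.swap_apply_eq_iff, Equiv.swap_apply_left, ← hBm] at h2
        exact h1.2 (hσB _ h2)
    · intro f _ g _ h
      exact funext fun w => σ.injective (congrFun h w)
  -- the common size of the families `f a = z, f b ∈ L`
  set n := Fintype.card V with hn'
  set h := Fintype.card W with hh
  have hnpos : 0 < n := by omega
  set M : ℕ := countMaps (fun f : W → V => f w₀ ∈ ({z} : Finset V) ∧ f u₀ ∈ L) with hM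
  have hMeq : ∀ a b : W, a ≠ b →
      countMaps (fun f : W → V => f a ∈ ({z} : Finset V) ∧ f b ∈ L) = M := by
    intro a b hab
    have h1 := countMaps_two_mem_mul hab ({z} : Finset V) L
    have h2 := countMaps_two_mem_mul hwu' ({z} : Finset V) L
    exact Nat.eq_of_mul_eq_mul_right (pow_pos hnpos 2) (h1.trans h2.symm)
  have hMpos : 0 < M := by
    have h2 := countMaps_two_mem_mul hwu' ({z} : Finset V) L
    refine Nat.pos_of_mul_pos_right (b := n ^ 2) ?_
    rw [hM, h2, card_singleton, one_mul]
    exact Nat.mul_pos hLpos (pow_pos hnpos _)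
  have hclass' : ∀ l, #{v | c' v = l} ≤ D := by
    intro l
    by_cases hl : l = j
    · refine le_trans ?_ (hD i)
      refine le_trans (card_le_card (t := insert z B) ?_)
        ((card_insert_le _ _).trans (by omega))
      intro v hv
      simp only [mem_filter, mem_univ, true_and, mem_insert, hBm] at hv ⊢
      by_cases hvz : v = z
      · exact Or.inl hvz
      · exact Or.inr (by rwa [hc'v v hvz, hl] at hv)
    · refine le_trans (card_le_card ?_) (hD l)
      intro v hv
      simp only [mem_filter, mem_univ, true_and] at hv ⊢
      by_cases hvz : v = z
      · rw [hvz, hc'z] at hv; exact absurd hv.symm hl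
      · rwa [hc'v v hvz] at hv
  -- lower bound for the gained maps
  have hgain : M * n ≤ #{f ∈ injMaps H (classGraph c') \ injMaps H (classGraph c) |
      ∃ w, f w ∈ L} * n + h ^ 2 * D * M := by
    have hcol := countMaps_collision_mul_le c' {w₀, u₀}
      (fun f : W → V => f w₀ ∈ ({z} : Finset V) ∧ f u₀ ∈ L)
      (by
        intro a ha f v
        simp only [mem_insert, mem_singleton, not_or] at ha
        simp [update_of_ne (Ne.symm ha.1), update_of_ne (Ne.symm ha.2)]) hclass'
    rw [← hM] at hcol
    refine le_trans ?_ (Nat.add_le_add_left hcol _)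
    rw [← add_mul]
    rw [hM, ← card_filter_eq_countMaps, ← card_filter_eq_countMaps]
    refine Nat.mul_le_mul_right _ (le_trans (card_le_card ?_) (card_union_le _ _))
    intro f hf
    simp only [mem_filter, mem_univ, true_and, mem_singleton] at hf
    simp only [mem_union, mem_filter, mem_sdiff, mem_injMaps, classGraph_adj, mem_univ, true_and,
      mem_singleton]
    by_cases hbad : ∃ a ∉ ({w₀, u₀} : Finset W), ∃ b ≠ a, c' (f a) = c' (f b)
    · exact Or.inr ⟨hf, hbad⟩
    left
    have hu := (hLm _).1 hf.2
    have hinj : Injective (c' ∘ f) := by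
      intro a b hab
      by_contra hne
      push Not at hbad
      have ha : a ∈ ({w₀, u₀} : Finset W) := by
        by_contra ha; exact hbad a ha b (Ne.symm hne) hab
      have hb : b ∈ ({w₀, u₀} : Finset W) := by
        by_contra hb; exact hbad b hb a hne hab.symm
      have hx : c' (f w₀) ≠ c' (f u₀) := by
        rw [hf.1, hc'z, hc'v _ hu.1.1, hu.1.2]; exact hij.symm
      simp only [mem_insert, mem_singleton] at ha hb
      simp only [comp_apply] at hab
      rcases ha with rfl | rfl <;> rcases hb with rfl | rfl
      · exact hne rfl
      · exact hx hab
      · exact hx hab.symm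
      · exact hne rfl
    refine ⟨⟨⟨hinj.of_comp, fun a b hab => hinj.ne hab.ne⟩, fun hcon => ?_⟩, u₀, hf.2⟩
    apply hcon.2 _ _ hwu
    rw [hf.1, hz, hu.1.2]
  -- upper bound for the lost maps
  have hlost : #{f ∈ injMaps H (classGraph c) \ injMaps H (classGraph c') |
      ∃ w, f w ∈ L} * n ≤ h ^ 3 * D * M := by
    -- Only an edge from `z` to `B` can be destroyed, and together with the point sent to `L` this
    -- prescribes three distinct coordinates.
    have hsub : {f ∈ injMaps H (classGraph c) \ injMaps H (classGraph c') | ∃ w, f w ∈ L} ⊆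
        ({p : W × W × W | p.1 ≠ p.2.2 ∧ p.2.1 ≠ p.1 ∧ p.2.1 ≠ p.2.2} :
          Finset (W × W × W)).biUnion fun p =>
          {f : W → V | (f p.1 ∈ ({z} : Finset V) ∧ f p.2.2 ∈ L) ∧ f p.2.1 ∈ B} := by
      intro f hf
      simp only [mem_filter, mem_sdiff, mem_injMaps, classGraph_adj, not_and, not_forall,
        not_not] at hf
      obtain ⟨⟨⟨hinj, hadj⟩, hnot⟩, w, hw⟩ := hf
      obtain ⟨a, b, hab, heq⟩ := hnot hinj
      obtain ⟨a, b, hab, haz, hbj⟩ : ∃ a b, H.Adj a b ∧ f a = z ∧ c (f b) = j := by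
        by_cases haz : f a = z
        · refine ⟨a, b, hab, haz, ?_⟩
          rw [haz, hc'z, hc'v _ (by rw [← haz]; exact hinj.ne hab.ne.symm)] at heq
          exact heq.symm
        by_cases hbz : f b = z
        · refine ⟨b, a, hab.symm, hbz, ?_⟩
          rwa [hbz, hc'z, hc'v _ haz] at heq
        · rw [hc'v _ haz, hc'v _ hbz] at heq
          exact absurd heq (hadj a b hab)
      have hwL := (hLm _).1 hw
      simp only [mem_biUnion, mem_filter, mem_univ, true_and, Prod.exists, mem_singleton]
      refine ⟨a, b, w, ⟨?_, hab.ne.symm, ?_⟩, ⟨haz, hw⟩, (hBm _).2 hbj⟩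
      · rintro rfl; exact hwL.1.1 haz
      · rintro rfl; exact hij (hwL.1.2.symm.trans hbj)
    have hle := (card_le_card hsub).trans card_biUnion_le
    simp only [card_filter_eq_countMaps (W := W) (V := V)] at hle
    calc _ ≤ (∑ p : W × W × W with p.1 ≠ p.2.2 ∧ p.2.1 ≠ p.1 ∧ p.2.1 ≠ p.2.2,
          countMaps fun f : W → V =>
            (f p.1 ∈ ({z} : Finset V) ∧ f p.2.2 ∈ L) ∧ f p.2.1 ∈ B) * n :=
          Nat.mul_le_mul_right _ hle
      _ = ∑ p : W × W × W with p.1 ≠ p.2.2 ∧ p.2.1 ≠ p.1 ∧ p.2.1 ≠ p.2.2,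
          countMaps (fun f : W → V =>
            (f p.1 ∈ ({z} : Finset V) ∧ f p.2.2 ∈ L) ∧ f p.2.1 ∈ B) * n := by
          rw [sum_mul]
      _ ≤ ∑ p : W × W × W with p.1 ≠ p.2.2 ∧ p.2.1 ≠ p.1 ∧ p.2.1 ≠ p.2.2, D * M := by
          refine sum_le_sum fun p hp => ?_
          simp only [mem_filter, mem_univ, true_and] at hp
          rw [countMaps_coord_mem_mul p.2.1
            (fun f : W → V => f p.1 ∈ ({z} : Finset V) ∧ f p.2.2 ∈ L) B
            (by simp [update_of_ne (Ne.symm hp.2.1), update_of_ne (Ne.symm hp.2.2)]),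
            hMeq _ _ hp.1]
          exact Nat.mul_le_mul_right _ (hD j)
      _ ≤ h ^ 3 * (D * M) := by
          rw [sum_const, smul_eq_mul]
          refine Nat.mul_le_mul_right _ ((card_le_univ _).trans ?_)
          rw [Fintype.card_prod, Fintype.card_prod, ← hh]
          exact le_of_eq (by ring)
      _ = _ := by ring
  -- conclusion
  have hstrict : #{f ∈ injMaps H (classGraph c) \ injMaps H (classGraph c') | ∃ w, f w ∈ L} <
      #{f ∈ injMaps H (classGraph c') \ injMaps H (classGraph c) | ∃ w, f w ∈ L} := by
    have h1 : (h ^ 2 + h ^ 3) * D * M < n * M := Nat.mul_lt_mul_of_pos_right hn hMpos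
    refine Nat.lt_of_mul_lt_mul_right (a := n) ?_
    nlinarith
  -- The maps common to both graphs cancel, so only gained and lost ones matter.
  have hsplit : ∀ X Y : Finset (W → V), #{f ∈ X | ∃ w, f w ∈ L} =
      #{f ∈ X \ Y | ∃ w, f w ∈ L} + #{f ∈ X ∩ Y | ∃ w, f w ∈ L} := by
    intro X Y
    rw [← card_union_of_disjoint, ← filter_union, sdiff_union_inter]
    exact disjoint_filter_filter (disjoint_sdiff_inter X Y)
  have e1 := card_filter_add_card_filter_not (s := injMaps H (classGraph c))
    (fun f => ∃ w, f w ∈ L)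
  have e2 := card_filter_add_card_filter_not (s := injMaps H (classGraph c'))
    (fun f => ∃ w, f w ∈ L)
  have e3 := hsplit (injMaps H (classGraph c)) (injMaps H (classGraph c'))
  have e4 := hsplit (injMaps H (classGraph c')) (injMaps H (classGraph c))
  rw [inter_comm] at e4
  omega


/-! ### Extremal graphs have no large class. -/

lemma pow_card_mul_le_card_injMaps {W V ι : Type*} [Fintype W] [Fintype V] [DecidableEq ι]
    (H : SimpleGraph W) (c : V → ι) {D : ℕ} (hD : ∀ l, #{v | c v = l} ≤ D) :
    Fintype.card V ^ Fintype.card W * Fintype.card V ≤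
      #(injMaps H (classGraph c)) * Fintype.card V +
        Fintype.card W ^ 2 * D * Fintype.card V ^ Fintype.card W := by
  classical
  have hcol := countMaps_collision_mul_le (W := W) c ∅ (fun _ => True) (by simp) hD
  have hall : countMaps (fun _ : W → V => True) = Fintype.card V ^ Fintype.card W := by
    rw [← card_filter_eq_countMaps]; simp
  rw [hall, ← card_filter_eq_countMaps] at hcol
  refine le_trans ?_ (Nat.add_le_add_left hcol _)
  rw [← add_mul, ← Fintype.card_fun, ← card_univ]
  refine Nat.mul_le_mul_right _ (le_trans (card_le_card ?_) (card_union_le _ _))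
  intro f _
  simp only [mem_union, mem_filter, mem_injMaps, classGraph_adj, mem_univ, true_and]
  by_cases hbad : ∃ a ∉ (∅ : Finset W), ∃ b ≠ a, c (f a) = c (f b)
  · exact Or.inr hbad
  · push Not at hbad
    have hinj : Injective (c ∘ f) := fun a b hab => by
      by_contra hne
      exact hbad a (notMem_empty a) b (Ne.symm hne) hab
    exact Or.inl ⟨hinj.of_comp, fun a b hab => hinj.ne hab.ne⟩

/-- Maps sending both ends of the edge `ab` into class `i` are never homomorphisms. -/
lemma card_injMaps_mul_add_le {W V ι : Type*} [Fintype W] [Fintype V] [DecidableEq ι]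
    (H : SimpleGraph W) {a b : W} (hab : H.Adj a b) (c : V → ι) (i : ι) :
    #(injMaps H (classGraph c)) * Fintype.card V ^ 2 +
        #{v | c v = i} ^ 2 * Fintype.card V ^ Fintype.card W ≤
      Fintype.card V ^ Fintype.card W * Fintype.card V ^ 2 := by
  classical
  have h2 := countMaps_two_mem_mul hab.ne ({v | c v = i} : Finset V) {v | c v = i}
  rw [pow_two #{v | c v = i}, ← h2, ← add_mul, ← card_filter_eq_countMaps,
    ← card_union_of_disjoint]
  · refine Nat.mul_le_mul_right _ ?_
    rw [← Fintype.card_fun]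
    exact card_le_univ _
  · rw [Finset.disjoint_left]
    intro f hf hf'
    simp only [mem_injMaps, classGraph_adj, mem_filter, mem_univ, true_and] at hf hf'
    exact hf.2 a b hab (hf'.1.trans hf'.2.symm)

/-- A colouring that is at least as good as some colouring with small classes has no large
class. -/
lemma card_class_sq_le {W V ι κ : Type*} [Fintype W] [Fintype V] [DecidableEq ι] [DecidableEq κ]
    [Nonempty V] (H : SimpleGraph W) {a b : W} (hab : H.Adj a b) (t : V → κ) (c : V → ι) {T : ℕ}
    (hT : ∀ l, #{v | t v = l} ≤ T)
    (hle : #(injMaps H (classGraph t)) ≤ #(injMaps H (classGraph c))) (i : ι) :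
    #{v | c v = i} ^ 2 ≤ Fintype.card W ^ 2 * T * Fintype.card V := by
  have h1 := pow_card_mul_le_card_injMaps H t hT
  have h2 := card_injMaps_mul_add_le H hab c i
  have hn : 0 < Fintype.card V := Fintype.card_pos
  set n := Fintype.card V
  have hN : 0 < n ^ Fintype.card W := pow_pos hn _
  set N := n ^ Fintype.card W
  refine Nat.le_of_mul_le_mul_right ?_ hN
  have h3 := Nat.mul_le_mul_right n h1
  have h4 := Nat.mul_le_mul_right (n ^ 2) hle
  nlinarith

/-! ### Zykov symmetrization. -/

section Zykov

variable {W V : Type*} [Fintype W] [Fintype V]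

/-- `G` maximizes, among the `k`-clique-free graphs, first the number of injective maps from `H`
and then the number of edges. -/
structure IsLexExtremal (H : SimpleGraph W) (k : ℕ) (G : SimpleGraph V) : Prop where
  cliqueFree : G.CliqueFree k
  card_injMaps_le : ∀ G' : SimpleGraph V, G'.CliqueFree k → #(injMaps H G') ≤ #(injMaps H G)
  ncard_edgeSet_le : ∀ G' : SimpleGraph V, G'.CliqueFree k →
    #(injMaps H G') = #(injMaps H G) → G'.edgeSet.ncard ≤ G.edgeSet.ncard

lemma exists_isLexExtremal (H : SimpleGraph W) {k : ℕ} (hk : 2 ≤ k) :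
    ∃ G : SimpleGraph V, IsLexExtremal H k G := by
  classical
  obtain ⟨G, hG, hmax⟩ := exists_max_image
    ({G | G.CliqueFree k} : Finset (SimpleGraph V))
    (fun G => toLex (#(injMaps H G), G.edgeSet.ncard))
    ⟨⊥, by simpa using SimpleGraph.cliqueFree_bot hk⟩
  simp only [mem_filter, mem_univ, true_and, Prod.Lex.toLex_le_toLex] at hG hmax
  refine ⟨G, hG, fun G' h => ?_, fun G' h he => ?_⟩
  · rcases hmax G' h with h | h
    · exact h.le
    · exact h.1.le
  · rcases hmax G' h with h | h
    · exact absurd he h.ne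
    · exact h.2

variable [DecidableEq V]

-- Maps that hit `t` only if they hit `s` survive cloning `s` onto `t`; those hitting `s` but not
-- `t` also yield a second map through the clone.
open Classical in
lemma card_injMaps_replaceVertex_ge {H : SimpleGraph W} (hH : H.IsCompleteMultipartite)
    (G : SimpleGraph V) {s t : V} (hn : ¬ G.Adj s t) :
    #{f ∈ injMaps H G | (∃ w, f w = t) → ∃ w, f w = s} +
        #{f ∈ injMaps H G | (∃ w, f w = s) ∧ ¬ ∃ w, f w = t} ≤
      #(injMaps H (G.replaceVertex s t)) := by
  have hinj : Injective (fun f : W → V => Equiv.swap s t ∘ f) := fun f g h =>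
    funext fun w => (Equiv.swap s t).injective (congrFun h w)
  rw [← card_image_of_injective {f ∈ injMaps H G | (∃ w, f w = s) ∧ ¬ ∃ w, f w = t} hinj,
    ← card_union_of_disjoint]
  · refine card_le_card (union_subset ?_ ?_)
    · intro f hf
      simp only [mem_filter, mem_injMaps] at hf ⊢
      obtain ⟨⟨hf, hadj⟩, hst'⟩ := hf
      refine ⟨hf, ?_⟩
      have key : ∀ a b, H.Adj a b → f a = t → (G.replaceVertex s t).Adj (f a) (f b) := by
        intro a b hab ha
        obtain ⟨w, hw⟩ := hst' ⟨a, ha⟩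
        have hb : f b ≠ t := by rw [← ha]; exact hf.ne hab.ne.symm
        rw [ha, G.adj_replaceVertex_iff_of_ne_right s hb, ← hw]
        apply hadj
        -- Since `s` and `t` are nonadjacent, so are `a` and `w`; they lie in one part of `H` and
        -- have the same neighbours.
        by_contra hwb
        refine hH.trans a w b (fun h => hn ?_) hwb hab
        rw [← hw, ← ha]
        exact (hadj a w h).symm
      intro a b hab
      by_cases ha : f a = t
      · exact key a b hab ha
      by_cases hb : f b = t
      · exact (key b a hab.symm hb).symm
      · exact (G.adj_replaceVertex_iff_of_ne s ha hb).2 (hadj a b hab)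
    · intro g hg
      simp only [mem_image, mem_filter, mem_injMaps] at hg
      obtain ⟨f, ⟨⟨hf, hadj⟩, -, hft⟩, rfl⟩ := hg
      push Not at hft
      rw [mem_injMaps]
      refine ⟨(Equiv.swap s t).injective.comp hf, ?_⟩
      have key : ∀ a b, H.Adj a b → f a = s → (G.replaceVertex s t).Adj
          (Equiv.swap s t (f a)) (Equiv.swap s t (f b)) := by
        intro a b hab ha
        have hb : f b ≠ s := by rw [← ha]; exact hf.ne hab.ne.symm
        rw [Equiv.swap_apply_of_ne_of_ne hb (hft b), ha, Equiv.swap_apply_left,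
          G.adj_replaceVertex_iff_of_ne_right s (hft b), ← ha]
        exact hadj a b hab
      intro a b hab
      by_cases ha : f a = s
      · exact key a b hab ha
      by_cases hb : f b = s
      · exact (key b a hab.symm hb).symm
      · simp only [comp_apply]
        rw [Equiv.swap_apply_of_ne_of_ne ha (hft a), Equiv.swap_apply_of_ne_of_ne hb (hft b),
          G.adj_replaceVertex_iff_of_ne s (hft a) (hft b)]
        exact hadj a b hab
  · rw [Finset.disjoint_left]
    intro g hg hg'
    simp only [mem_image, mem_filter] at hg hg'
    obtain ⟨f, ⟨-, ⟨w, hw⟩, hft⟩, rfl⟩ := hg'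
    obtain ⟨w', hw'⟩ := hg.2 ⟨w, by simp [hw]⟩
    refine hft ⟨w', ?_⟩
    simp only [comp_apply] at hw'
    rw [Equiv.swap_apply_eq_iff, Equiv.swap_apply_left] at hw'
    exact hw'

/-- Symmetrizing a pair of nonadjacent vertices both ways does not decrease the average number of
copies of a complete multipartite graph. -/
lemma two_mul_card_injMaps_le {H : SimpleGraph W} (hH : H.IsCompleteMultipartite)
    (G : SimpleGraph V) {s t : V} (hn : ¬ G.Adj s t) :
    2 * #(injMaps H G) ≤
      #(injMaps H (G.replaceVertex s t)) + #(injMaps H (G.replaceVertex t s)) := by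
  classical
  by_cases hst : s = t
  · subst hst
    rw [SimpleGraph.replaceVertex_self, two_mul]
  have h1 := card_injMaps_replaceVertex_ge hH G hn
  have h2 := card_injMaps_replaceVertex_ge hH G fun h => hn h.symm
  have split : ∀ x y : V, #(injMaps H G) =
      #{f ∈ injMaps H G | (∃ w, f w = y) → ∃ w, f w = x} +
        #{f ∈ injMaps H G | (∃ w, f w = y) ∧ ¬ ∃ w, f w = x} := by
    intro x y
    rw [← card_filter_add_card_filter_not (s := injMaps H G)
      (fun f => (∃ w, f w = y) → ∃ w, f w = x)]
    congr 2
    ext f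
    simp only [mem_filter, Classical.not_imp]
  have h3 := split s t
  have h4 := split t s
  omega

namespace IsLexExtremal

variable {H : SimpleGraph W} {k : ℕ} {G : SimpleGraph V}

lemma card_injMaps_replaceVertex (hG : IsLexExtremal H k G) (hH : H.IsCompleteMultipartite)
    {s t : V} (hn : ¬ G.Adj s t) : #(injMaps H (G.replaceVertex s t)) = #(injMaps H G) := by
  have h1 := hG.card_injMaps_le _ (hG.cliqueFree.replaceVertex s t)
  have h2 := hG.card_injMaps_le _ (hG.cliqueFree.replaceVertex t s)
  have h3 := two_mul_card_injMaps_le hH G hn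
  omega

/-- Cloning keeps the number of maps, so the edge tie-break forbids it from gaining edges in either
direction. -/
lemma degree_eq [DecidableRel G.Adj] (hG : IsLexExtremal H k G) (hH : H.IsCompleteMultipartite)
    {s t : V} (hn : ¬ G.Adj s t) : G.degree s = G.degree t := by
  have key : ∀ s t, ¬ G.Adj s t → G.degree s ≤ G.degree t := by
    intro s t hn
    have h := hG.ncard_edgeSet_le _ (hG.cliqueFree.replaceVertex s t)
      (hG.card_injMaps_replaceVertex hH hn)
    rw [← SimpleGraph.coe_edgeFinset, ← SimpleGraph.coe_edgeFinset, Set.ncard_coe_finset,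
      Set.ncard_coe_finset, G.card_edgeFinset_replaceVertex_of_not_adj hn] at h
    omega
  exact le_antisymm (key s t hn) (key t s fun h => hn h.symm)

/-- Otherwise, cloning `s` onto `t` gives another extremal graph in which `u` has lost the neighbour
`t` while `s` keeps its degree, although `s` and `u` are still nonadjacent. -/
lemma not_adj_trans (hG : IsLexExtremal H k G) (hH : H.IsCompleteMultipartite) {t s u : V}
    (hts : ¬ G.Adj t s) (hsu : ¬ G.Adj s u) : ¬ G.Adj t u := by
  classical
  intro htu
  have hst : ¬ G.Adj s t := fun h => hts h.symm
  have nst : s ≠ t := fun h => hsu (h ▸ htu)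
  have ntu : t ≠ u := G.ne_of_adj htu
  have hI := hG.card_injMaps_replaceVertex hH hst
  have hG' : IsLexExtremal H k (G.replaceVertex s t) := by
    refine ⟨hG.cliqueFree.replaceVertex s t, fun G' h => hI ▸ hG.card_injMaps_le G' h,
      fun G' h he => (hG.ncard_edgeSet_le G' h (he.trans hI)).trans (le_of_eq ?_)⟩
    rw [← SimpleGraph.coe_edgeFinset, ← SimpleGraph.coe_edgeFinset, Set.ncard_coe_finset,
      Set.ncard_coe_finset, G.card_edgeFinset_replaceVertex_of_not_adj hst, hG.degree_eq hH hst,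
      Nat.add_sub_cancel]
  have hdeg := hG'.degree_eq hH ((G.adj_replaceVertex_iff_of_ne s nst ntu.symm).not.mpr hsu)
  have l1 : (G.replaceVertex s t).degree s = G.degree s := by
    unfold SimpleGraph.degree; congr 1; ext v
    simp_rw [SimpleGraph.mem_neighborFinset]
    by_cases eq : v = t
    · simpa only [eq, G.not_adj_replaceVertex_same, false_iff]
    · rw [G.adj_replaceVertex_iff_of_ne s nst eq]
  have l2 : (G.replaceVertex s t).degree u = G.degree u - 1 := by
    rw [SimpleGraph.degree, SimpleGraph.degree, ← card_singleton t,
      ← card_sdiff_of_subset (by simp [htu.symm])]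
    congr 1; ext v
    simp_rw [SimpleGraph.mem_neighborFinset, mem_sdiff, mem_singleton, SimpleGraph.replaceVertex]
    split_ifs <;> simp_all [SimpleGraph.adj_comm]
  have l3 : 0 < G.degree u := by rw [G.degree_pos_iff_exists_adj u]; use t, htu.symm
  have l4 := hG.degree_eq hH hsu
  omega

lemma exists_classGraph_eq {r : ℕ} (hG : IsLexExtremal H (r + 1) G)
    (hH : H.IsCompleteMultipartite) : ∃ c : V → Fin r, G = classGraph c := by
  classical
  let S : Setoid V := ⟨fun u v => ¬ G.Adj u v,
    ⟨fun _ => G.irrefl, fun h h' => h h'.symm, hG.not_adj_trans hH⟩⟩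
  have hcard : Fintype.card (Quotient S) ≤ r := by
    by_contra! hlt
    -- Representatives of the nonadjacency classes form a clique.
    have hcont : (⊤ : SimpleGraph (Quotient S)).IsContained G :=
      ⟨⟨⟨Quotient.out, fun {p q} hpq => by
        by_contra h
        exact hpq (Quotient.out_equiv_out.1 h)⟩, Quotient.out_injective⟩⟩
    have hfree : G.CliqueFree (Fintype.card (Quotient S)) :=
      SimpleGraph.CliqueFree.mono (Nat.succ_le_of_lt hlt) hG.cliqueFree
    exact SimpleGraph.cliqueFree_iff_top_free.1 hfree hcont
  obtain ⟨e⟩ : Nonempty (Quotient S ↪ Fin r) :=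
    Function.Embedding.nonempty_of_card_le (by simpa using hcard)
  refine ⟨fun v => e (Quotient.mk S v), ?_⟩
  ext u v
  rw [classGraph_adj, e.injective.ne_iff, ne_eq, Quotient.eq]
  exact not_not.symm

end IsLexExtremal

end Zykov

/-! ### Recognizing the Turán graph. -/

/-- A surjective colouring with classes of almost equal sizes gives the Turán graph. -/
lemma nonempty_iso_turanGraph_of_balanced {n r : ℕ} (c : Fin n → Fin r) (hc : Surjective c)
    (hbal : ∀ i j, #{v | c v = i} ≤ #{v | c v = j} + 1) :
    Nonempty (classGraph c ≃g SimpleGraph.turanGraph n r) := by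
  classical
  let P : Finpartition (univ : Finset (Fin n)) := Finpartition.ofSetoid (Setoid.ker c)
  have hpart : ∀ v, P.part v = ({u | c u = c v} : Finset (Fin n)) := by
    intro v
    ext u
    rw [Finpartition.mem_part_ofSetoid_iff_rel, Setoid.ker_def]
    simp [eq_comm]
  have hparts : P.parts = univ.image fun i => ({u | c u = i} : Finset (Fin n)) := by
    ext p
    simp only [mem_image, mem_univ, true_and]
    constructor
    · intro hp
      obtain ⟨v, hv⟩ := P.nonempty_of_mem_parts hp
      exact ⟨c v, by rw [← hpart, P.part_eq_of_mem hp hv]⟩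
    · rintro ⟨i, rfl⟩
      obtain ⟨v, rfl⟩ := hc i
      rw [← hpart]
      exact P.part_mem.2 (mem_univ v)
  have hcard : #P.parts = r := by
    rw [hparts, card_image_of_injective, card_univ, Fintype.card_fin]
    intro i j hij
    obtain ⟨v, rfl⟩ := hc i
    have : v ∈ ({u | c u = j} : Finset (Fin n)) := by
      simp only [← hij]; simp
    simpa using this
  have heq : P.IsEquipartition := by
    by_contra hn
    rw [Finpartition.not_isEquipartition, hparts] at hn
    obtain ⟨A, hA, B, hB, hlt⟩ := hn
    simp only [mem_image, mem_univ, true_and] at hA hB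
    obtain ⟨i, rfl⟩ := hA
    obtain ⟨j, rfl⟩ := hB
    have := hbal i j
    omega
  obtain ⟨f, hf⟩ := heq.exists_partPreservingEquiv
  let e : Fin n ≃ Fin n := (Equiv.subtypeUnivEquiv mem_univ).symm.trans
    (f.trans (finCongr (by simp)))
  refine ⟨⟨e, fun {a b} => ?_⟩⟩
  have h := hf ⟨a, mem_univ a⟩ ⟨b, mem_univ b⟩
  rw [hcard, hpart, hpart] at h
  rw [SimpleGraph.turanGraph_adj, classGraph_adj, not_iff_not]
  refine Iff.trans h.symm ⟨fun h => ?_, fun h => by rw [h]⟩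
  have : a ∈ ({u | c u = c b} : Finset (Fin n)) := by rw [← h]; simp
  simpa using this

lemma card_mod_class_le (n r : ℕ) (l : ℕ) :
    #{v : Fin n | (v : ℕ) % r = l} ≤ n / r + 1 := by
  rw [← card_range (n / r + 1)]
  refine card_le_card_of_injOn (fun v => (v : ℕ) / r) ?_ ?_
  · intro v _
    simpa using Nat.lt_succ_of_le (Nat.div_le_div_right v.2.le)
  · intro v hv w hw h
    simp only [coe_filter, mem_univ, true_and, Set.mem_ofPred_eq] at hv hw h
    apply Fin.ext
    rw [← Nat.div_add_mod v r, ← Nat.div_add_mod w r, hv, hw, h]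

lemma turanGraph_eq_classGraph (n r : ℕ) :
    SimpleGraph.turanGraph n r = classGraph fun v : Fin n => (v : ℕ) % r := by
  ext u v
  rw [SimpleGraph.turanGraph_adj, classGraph_adj]

/-! ### From labelled maps to copies. -/

section CopyCount

variable {W V : Type*} [Fintype W] [Fintype V]

/-- Every copy of `H` in `G` is labelled in `|Aut H|` ways. -/
lemma card_injMaps_eq_copyCount_mul (H : SimpleGraph W) (G : SimpleGraph V) :
    #(injMaps H G) = G.copyCount H * Nat.card (H ≃g H) := by
  classical
  -- An injective homomorphism is the same as its image copy together with a labelling of that copy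
  -- by `H`.
  let X := Σ G' : {G' : G.Subgraph // Nonempty (H ≃g G'.coe)}, H ≃g G'.1.coe
  let m : X → {f // f ∈ injMaps H G} := fun x => ⟨fun w => (x.2 w : V), mem_injMaps.2
    ⟨fun a b h => x.2.injective (Subtype.ext h),
      fun a b h => x.1.1.coe_adj_sub _ _ (x.2.map_adj_iff.2 h)⟩⟩
  have hm : Bijective m := by
    constructor
    · rintro ⟨⟨G₁, h₁⟩, e₁⟩ ⟨⟨G₂, h₂⟩, e₂⟩ h
      have h' : ∀ w, (e₁ w : V) = e₂ w := fun w => congrFun (congrArg Subtype.val h) w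
      have key : ∀ {G₁ G₂ : G.Subgraph} (e₁ : H ≃g G₁.coe) (e₂ : H ≃g G₂.coe),
          (∀ w, (e₁ w : V) = e₂ w) → G₁ ≤ G₂ := by
        intro G₁ G₂ e₁ e₂ h
        refine ⟨fun v hv => ?_, fun u v huv => ?_⟩
        · have := h (e₁.symm ⟨v, hv⟩)
          simp only [RelIso.apply_symm_apply] at this
          rw [this]
          exact (e₂ _).2
        · have h1 : G₁.coe.Adj ⟨u, huv.fst_mem⟩ ⟨v, huv.snd_mem⟩ := huv
          rw [← e₁.symm.map_adj_iff, ← e₂.map_adj_iff] at h1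
          have h2 := h (e₁.symm ⟨u, huv.fst_mem⟩)
          have h3 := h (e₁.symm ⟨v, huv.snd_mem⟩)
          simp only [RelIso.apply_symm_apply] at h2 h3
          rw [SimpleGraph.Subgraph.coe_adj] at h1
          rwa [← h2, ← h3] at h1
      obtain rfl : G₁ = G₂ := le_antisymm (key e₁ e₂ h') (key e₂ e₁ fun w => (h' w).symm)
      obtain rfl : e₁ = e₂ := RelIso.ext fun w => Subtype.ext (h' w)
      rfl
    · rintro ⟨f, hf⟩
      rw [mem_injMaps] at hf
      let f' : SimpleGraph.Copy H G := ⟨⟨f, fun {a b} h => hf.2 a b h⟩, hf.1⟩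
      exact ⟨⟨⟨f'.toSubgraph, ⟨f'.isoToSubgraph⟩⟩, f'.isoToSubgraph⟩, rfl⟩
  have h1 := Nat.card_congr (Equiv.ofBijective m hm)
  rw [Nat.card_eq_fintype_card (α := {f // f ∈ injMaps H G}), Fintype.card_coe] at h1
  have hfin : ∀ {V' : Type _} (G' : SimpleGraph V') [Finite V'], Finite (H ≃g G') :=
    fun G' _ => Finite.of_injective (fun e => (e : W → _)) DFunLike.coe_injective
  have := fun G' : {G' : G.Subgraph // Nonempty (H ≃g G'.coe)} => hfin G'.1.coe
  rw [← h1, Nat.card_sigma]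
  have h2 : ∀ G' : {G' : G.Subgraph // Nonempty (H ≃g G'.coe)},
      Nat.card (H ≃g G'.1.coe) = Nat.card (H ≃g H) := by
    rintro ⟨G', ⟨e⟩⟩
    exact Nat.card_congr ⟨fun x => x.trans e.symm, fun x => x.trans e,
      fun x => by ext; simp, fun x => by ext; simp⟩
  rw [sum_congr rfl fun G' _ => h2 G', sum_const, smul_eq_mul, card_univ,
    SimpleGraph.copyCount, Fintype.card_subtype]

lemma copyCount_le_of_card_injMaps_le {V' : Type*} [Fintype V'] {H : SimpleGraph W}
    {G : SimpleGraph V} {G' : SimpleGraph V'} (h : #(injMaps H G) ≤ #(injMaps H G')) :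
    G.copyCount H ≤ G'.copyCount H := by
  rw [card_injMaps_eq_copyCount_mul, card_injMaps_eq_copyCount_mul] at h
  have : Finite (H ≃g H) :=
    Finite.of_injective (fun e : H ≃g H => (e : W → W)) DFunLike.coe_injective
  have : Nonempty (H ≃g H) := ⟨SimpleGraph.Iso.refl⟩
  exact Nat.le_of_mul_le_mul_right h Nat.card_pos

end CopyCount

/-! ### Extremality of the Turán graph. -/

lemma card_injMaps_le_of_iso {W V V' : Type*} [Fintype W] [Fintype V] [Fintype V']
    (H : SimpleGraph W) {G : SimpleGraph V} {G' : SimpleGraph V'} (e : G ≃g G') :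
    #(injMaps H G) ≤ #(injMaps H G') := by
  refine card_le_card_of_injOn (fun f => e ∘ f) ?_ ?_
  · intro f hf
    simp only [mem_coe, mem_injMaps] at hf ⊢
    exact ⟨e.injective.comp hf.1, fun a b h => e.map_adj_iff.2 (hf.2 a b h)⟩
  · intro f _ g _ h
    exact funext fun w => e.injective (congrFun h w)

lemma classGraph_cliqueFree {V : Type*} {r : ℕ} (c : V → Fin r) :
    (classGraph c).CliqueFree (r + 1) :=
  SimpleGraph.Colorable.cliqueFree ⟨⟨c, fun {_ _} h => h⟩⟩ r.lt_succ_self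

/-- The Turán graph has the most copies of a complete multipartite graph among all
`(r + 1)`-clique-free graphs, when `r` is large and there are at least `r` vertices. -/
lemma card_injMaps_le_turanGraph {W : Type*} [Fintype W] {H : SimpleGraph W}
    (hH : H.IsCompleteMultipartite) {n r : ℕ}
    (hr : 2 * (Fintype.card W ^ 2 + Fintype.card W ^ 3) ^ 2 * Fintype.card W ^ 2 < r)
    (hrn : r ≤ n) {G : SimpleGraph (Fin n)} (hG : G.CliqueFree (r + 1)) :
    #(injMaps H G) ≤ #(injMaps H (SimpleGraph.turanGraph n r)) := by
  classical
  by_cases hedge : ∃ a b, H.Adj a b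
  swap
  · push Not at hedge
    refine card_le_card fun f hf => ?_
    rw [mem_injMaps] at hf ⊢
    exact ⟨hf.1, fun a b h => absurd h (hedge a b)⟩
  obtain ⟨a, b, hab⟩ := hedge
  have hr0 : 0 < r := by omega
  obtain ⟨E, hE⟩ := exists_isLexExtremal (V := Fin n) H (k := r + 1) (by omega)
  refine (hE.card_injMaps_le G hG).trans ?_
  obtain ⟨c, rfl⟩ := hE.exists_classGraph_eq hH
  have hT := hE.card_injMaps_le _ (SimpleGraph.turanGraph_cliqueFree (n := n) hr0)
  rw [turanGraph_eq_classGraph] at hT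
  have : Nonempty (Fin n) := ⟨⟨0, by omega⟩⟩
  have : Nonempty (Fin r) := ⟨⟨0, hr0⟩⟩
  obtain ⟨m, -, hm⟩ := exists_max_image (univ : Finset (Fin r)) (fun i => #{v | c v = i})
    univ_nonempty
  have hsq := card_class_sq_le H hab _ c (card_mod_class_le n r) hT m
  rw [Fintype.card_fin] at hsq
  set D := #{v | c v = m}
  set h := Fintype.card W
  set K := h ^ 2 + h ^ 3
  have hKD : K * D < n := by
    set T := n / r + 1
    -- The rounding term `r` is absorbed by `r ≤ n`, which produces the factor 2 in `hr`.
    have hTr : T * r ≤ 2 * n := by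
      have := Nat.div_mul_le_self n r
      simp only [T]
      nlinarith
    have h1 : K ^ 2 * h ^ 2 * T < n := by
      refine Nat.lt_of_mul_lt_mul_right (a := r) ?_
      calc K ^ 2 * h ^ 2 * T * r = K ^ 2 * h ^ 2 * (T * r) := by ring
        _ ≤ K ^ 2 * h ^ 2 * (2 * n) := Nat.mul_le_mul_left _ hTr
        _ = (2 * K ^ 2 * h ^ 2) * n := by ring
        _ < r * n := Nat.mul_lt_mul_of_pos_right hr (by omega)
        _ = n * r := mul_comm _ _
    refine lt_of_pow_lt_pow_left₀ 2 (Nat.zero_le n) ?_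
    calc (K * D) ^ 2 = K ^ 2 * D ^ 2 := by ring
      _ ≤ K ^ 2 * (h ^ 2 * T * n) := Nat.mul_le_mul_left _ hsq
      _ = K ^ 2 * h ^ 2 * T * n := by ring
      _ < n * n := Nat.mul_lt_mul_of_pos_right h1 (by omega)
      _ = n ^ 2 := (pow_two n).symm
  have hbal : ∀ i j, #{v | c v = i} ≤ #{v | c v = j} + 1 := by
    intro i j
    by_contra! hlt
    obtain ⟨z, hz⟩ : ({v | c v = i} : Finset (Fin n)).Nonempty := card_pos.1 (by omega)
    have hij : i ≠ j := by rintro rfl; omega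
    have h1 := card_injMaps_lt_of_exchange H hab c hij (by simpa using hz)
      (fun l => hm l (mem_univ l)) hlt (by simpa using hKD)
    exact absurd (hE.card_injMaps_le _ (classGraph_cliqueFree _)) (not_le.2 h1)
  -- An empty class would force all classes to have at most one vertex, hence `n < r`.
  have hsurj : Surjective c := by
    by_contra hns
    simp only [Surjective, not_forall, not_exists] at hns
    obtain ⟨j, hj⟩ := hns
    have hj0 : #{v | c v = j} = 0 := by simpa [filter_eq_empty_iff] using hj
    have hsum : n = ∑ i, #{v | c v = i} := by
      have := card_eq_sum_card_fiberwise (f := c) (s := univ) (t := univ) (by simp)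
      simpa using this
    have : ∑ i, #{v | c v = i} < ∑ i : Fin r, 1 := by
      refine sum_lt_sum (fun i _ => ?_) ⟨j, mem_univ j, by omega⟩
      have := hbal i j
      omega
    simp at this
    omega
  obtain ⟨e⟩ := nonempty_iso_turanGraph_of_balanced c hsurj hbal
  exact card_injMaps_le_of_iso H e

end GenTuran

theorem theorem2p3 {W : Type*} [Finite W] (H : SimpleGraph W) (hH : H.IsCompleteMultipartite) :
    ∃ k₀ : ℕ, ∀ k : ℕ, k₀ ≤ k → GenTuran.IsCliqueTuranGood k H := by
  classical
  have := Fintype.ofFinite W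
  -- The first term serves the class-size bound and `Fintype.card W` makes `H` itself `K_k`-free;
  -- the 2 covers `k = r + 1` and the strict inequality on `r`.
  refine ⟨2 * (Fintype.card W ^ 2 + Fintype.card W ^ 3) ^ 2 * Fintype.card W ^ 2 +
    Fintype.card W + 2, fun k hk => ?_⟩
  obtain ⟨r, rfl⟩ : ∃ r, k = r + 1 := ⟨k - 1, by omega⟩
  refine ⟨by simp, ?_, ?_⟩
  · have := SimpleGraph.cliqueFree_of_card_lt (G := H) (n := r + 1) (by omega)
    rwa [← Fintype.card_fin (r + 1), SimpleGraph.cliqueFree_iff_top_free] at this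
  · filter_upwards [Filter.eventually_ge_atTop r] with n hn
    rw [Nat.add_sub_cancel]
    have hfree : ∀ G : SimpleGraph (Fin n),
        (⊤ : SimpleGraph (Fin (r + 1))).Free G ↔ G.CliqueFree (r + 1) := by
      intro G
      rw [← SimpleGraph.cliqueFree_iff_top_free (β := Fin (r + 1)), Fintype.card_fin]
    apply le_antisymm
    · refine Finset.sup_le fun G hG => ?_
      rw [Finset.mem_filter, hfree] at hG
      exact GenTuran.copyCount_le_of_card_injMaps_le
        (GenTuran.card_injMaps_le_turanGraph hH (by omega) hn hG.2)
    · refine Finset.le_sup (f := fun G : SimpleGraph (Fin n) => G.copyCount H) ?_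
      rw [Finset.mem_filter, hfree]
      exact ⟨Finset.mem_univ _, SimpleGraph.turanGraph_cliqueFree (by omega)⟩
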